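/- Let $\mathbb{D}=\{z\in\mathbb{C}:|z|<1\}$ and $\overline{\mathbb{D}}=\{z\in\mathbb{C}:|z|\le 1\}$, and let $\varphi:\mathbb{D}\to\mathbb{D}$ be an analytic function. There exists a unique continuous function $\omega:\overline{\mathbb{D}}\to\overline{\mathbb{D}}$ such that $\omega$ is analytic in $\mathbb{D}$, $\omega(0)=0$, and \[ \omega(z)=z\,\varphi(\omega(z)),\qquad z\in\mathbb{D}. \] (Any continuous $\omega:\overline{\mathbb{D}}\to\overline{\mathbb{D}}$ that is analytic in $\mathbb{D}$ with $\omega(0)=0$ maps $\mathbb{D}$ into $\mathbb{D}$, so that $\varphi(\omega(z))$ is defined for $z\in\mathbb{D}$.) -/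

import Mathlib

/-- `IsSubordination φ ω`: the restriction of `ω` to the closed unit disk is a continuous self-map of
the closed unit disk which is analytic in the open disk, vanishes at `0` and satisfies
`ω z = z * φ (ω z)` in the open disk.
Only the values of `ω` on the closed disk matter. -/
structure IsSubordination (φ ω : ℂ → ℂ) : Prop where
  mapsTo : Set.MapsTo ω (Metric.closedBall 0 1) (Metric.closedBall 0 1)
  continuousOn : ContinuousOn ω (Metric.closedBall 0 1)
  analyticOnNhd : AnalyticOnNhd ℂ ω (Metric.ball 0 1)
  map_zero : ω 0 = 0
  eq : ∀ z ∈ Metric.ball (0 : ℂ) 1, ω z = z * φ (ω z)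

/-! For `|z| < 1`, the value `ω z` is the unique fixed point of `w ↦ z * φ w`. It exists because
multiplication by `z` strictly shrinks the pseudo-hyperbolic distance while `φ` does not increase
it; two fixed points would force the identity by equality in Schwarz's lemma. The harder point is
the boundary. The Schwarz–Pick inequality at a fixed point, cleared of the factor `1 - |a|²`,
survives limits to the circle: every cluster point of `ω` at `z` is a contraction centre of `w ↦ z *
φ w` (`isContractionCenter_of_tendsto`). Two distinct centres would make this map the identity
(`IsContractionCenter.eqOn_id`), which `φ 0 ≠ 0` excludes. So limits exist throughout the closed
disk; if `φ 0 = 0`, then `ω = 0` works. -/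

open Metric Set Filter Topology ComplexConjugate

/-! ### Disk automorphisms -/

/-- The involutive automorphism of the unit disk exchanging `0` and `a`. -/
noncomputable def diskInvolution (a w : ℂ) : ℂ := (a - w) / (1 - conj a * w)

theorem one_sub_conj_mul_ne_zero {a w : ℂ} (ha : ‖a‖ < 1) (hw : ‖w‖ < 1) :
    1 - conj a * w ≠ 0 := by
  intro h
  have h1 : ‖conj a * w‖ = 1 := by rw [← sub_eq_zero.1 h, norm_one]
  rw [norm_mul, Complex.norm_conj] at h1
  nlinarith [norm_nonneg a, norm_nonneg w]

theorem normSq_one_sub_conj_mul_sub (a w : ℂ) :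
    Complex.normSq (1 - conj a * w) - Complex.normSq (a - w)
      = (1 - Complex.normSq a) * (1 - Complex.normSq w) := by
  simp only [Complex.normSq_apply, Complex.sub_re, Complex.sub_im, Complex.mul_re, Complex.mul_im,
    Complex.conj_re, Complex.conj_im, Complex.one_re, Complex.one_im]
  ring

theorem normSq_lt_one_iff {a : ℂ} : Complex.normSq a < 1 ↔ ‖a‖ < 1 := by
  rw [Complex.normSq_eq_norm_sq, sq_lt_one_iff₀ (norm_nonneg a)]

theorem normSq_le_one_iff {a : ℂ} : Complex.normSq a ≤ 1 ↔ ‖a‖ ≤ 1 := by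
  rw [Complex.normSq_eq_norm_sq, sq_le_one_iff₀ (norm_nonneg a)]

theorem normSq_diskInvolution {a w : ℂ} (ha : ‖a‖ < 1) (hw : ‖w‖ < 1) :
    Complex.normSq (diskInvolution a w) = 1 -
      (1 - Complex.normSq a) * (1 - Complex.normSq w) / Complex.normSq (1 - conj a * w) := by
  have h := Complex.normSq_pos.2 (one_sub_conj_mul_ne_zero ha hw)
  rw [diskInvolution, map_div₀, ← normSq_one_sub_conj_mul_sub, sub_div, div_self h.ne',
    sub_sub_cancel]

theorem norm_diskInvolution_lt_one {a w : ℂ} (ha : ‖a‖ < 1) (hw : ‖w‖ < 1) :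
    ‖diskInvolution a w‖ < 1 := by
  have h := Complex.normSq_pos.2 (one_sub_conj_mul_ne_zero ha hw)
  rw [← normSq_lt_one_iff, normSq_diskInvolution ha hw, sub_lt_self_iff]
  rw [← normSq_lt_one_iff, ← sub_pos] at ha hw
  positivity

theorem diskInvolution_diskInvolution {a w : ℂ} (ha : ‖a‖ < 1) (hw : ‖w‖ < 1) :
    diskInvolution a (diskInvolution a w) = w := by
  have h := one_sub_conj_mul_ne_zero ha hw
  have h1 := one_sub_conj_mul_ne_zero ha (norm_diskInvolution_lt_one ha hw)
  have e : diskInvolution a w * (1 - conj a * w) = a - w := div_mul_cancel₀ _ h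
  rw [diskInvolution, div_eq_iff h1]
  refine mul_right_cancel₀ h ?_
  linear_combination (-1 + w * conj a) * e

theorem diskInvolution_self (a : ℂ) : diskInvolution a a = 0 := by simp [diskInvolution]

theorem diskInvolution_zero (a : ℂ) : diskInvolution a 0 = a := by simp [diskInvolution]

theorem diskInvolution_eq_zero_iff {a w : ℂ} (ha : ‖a‖ < 1) (hw : ‖w‖ < 1) :
    diskInvolution a w = 0 ↔ a = w := by
  rw [diskInvolution, div_eq_zero_iff, sub_eq_zero]
  simp [one_sub_conj_mul_ne_zero ha hw]

theorem hasDerivAt_diskInvolution {a w : ℂ} (ha : ‖a‖ < 1) (hw : ‖w‖ < 1) :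
    HasDerivAt (diskInvolution a) ((conj a * a - 1) / (1 - conj a * w) ^ 2) w := by
  have h := (((hasDerivAt_id w).const_sub a).div
    (((hasDerivAt_id w).const_mul (conj a)).const_sub 1) (one_sub_conj_mul_ne_zero ha hw))
  refine h.congr_deriv ?_
  simp only [id]
  ring

theorem mapsTo_diskInvolution {a : ℂ} (ha : ‖a‖ < 1) :
    MapsTo (diskInvolution a) (ball 0 1) (ball 0 1) := fun _ hw => by
  rw [mem_ball_zero_iff] at hw ⊢
  exact norm_diskInvolution_lt_one ha hw

theorem differentiableOn_diskInvolution {a : ℂ} (ha : ‖a‖ < 1) :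
    DifferentiableOn ℂ (diskInvolution a) (ball 0 1) := fun _ hw =>
  (hasDerivAt_diskInvolution ha
    (mem_ball_zero_iff.1 hw)).differentiableAt.differentiableWithinAt

/-! ### Schwarz–Pick and rigidity at fixed points -/

section SelfMap

variable {f : ℂ → ℂ}

theorem differentiableOn_conj_diskInvolution (hf : DifferentiableOn ℂ f (ball 0 1))
    (hm : MapsTo f (ball 0 1) (ball 0 1)) {a b : ℂ} (ha : ‖a‖ < 1) (hb : ‖b‖ < 1) :
    DifferentiableOn ℂ (diskInvolution b ∘ f ∘ diskInvolution a) (ball 0 1) :=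
  (differentiableOn_diskInvolution hb).comp
    (hf.comp (differentiableOn_diskInvolution ha) (mapsTo_diskInvolution ha))
    (hm.comp (mapsTo_diskInvolution ha))

theorem mapsTo_conj_diskInvolution
    (hm : MapsTo f (ball 0 1) (ball 0 1)) {a b : ℂ} (ha : ‖a‖ < 1) (hb : ‖b‖ < 1) :
    MapsTo (diskInvolution b ∘ f ∘ diskInvolution a) (ball 0 1) (ball 0 1) :=
  (mapsTo_diskInvolution hb).comp (hm.comp (mapsTo_diskInvolution ha))

/-- The **Schwarz–Pick lemma**. -/
theorem norm_diskInvolution_map_le (hf : DifferentiableOn ℂ f (ball 0 1))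
    (hm : MapsTo f (ball 0 1) (ball 0 1)) {a p : ℂ} (ha : ‖a‖ < 1) (hp : ‖p‖ < 1) :
    ‖diskInvolution (f a) (f p)‖ ≤ ‖diskInvolution a p‖ := by
  have hfa : ‖f a‖ < 1 := mem_ball_zero_iff.1 (hm (mem_ball_zero_iff.2 ha))
  have h := Complex.norm_le_norm_of_mapsTo_ball
    (differentiableOn_conj_diskInvolution hf hm ha hfa)
    ((mapsTo_conj_diskInvolution hm ha hfa).mono_right ball_subset_closedBall)
    (by simp [diskInvolution_zero, diskInvolution_self])
    (norm_diskInvolution_lt_one ha hp)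
  simpa [diskInvolution_diskInvolution ha hp] using h

/-- Conjugation moves the fixed point to `0`, and a difference quotient of modulus `1` there is the
equality case of Schwarz's lemma. Taking `q ≠ 0` treats a second fixed point, `q = 0` a derivative
equal to `1`. -/
theorem eqOn_id_of_norm_dslope_conj (hf : DifferentiableOn ℂ f (ball 0 1))
    (hm : MapsTo f (ball 0 1) (ball 0 1)) {a q : ℂ} (ha : ‖a‖ < 1) (hfa : f a = a)
    (hq : ‖q‖ < 1) (h : dslope (diskInvolution a ∘ f ∘ diskInvolution a) 0 q = 1) :
    EqOn f id (ball 0 1) := by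
  set g := diskInvolution a ∘ f ∘ diskInvolution a with hg
  have hg0 : g 0 = 0 := by simp [hg, diskInvolution_zero, diskInvolution_self, hfa]
  have key := Complex.affine_of_mapsTo_ball_of_norm_dslope_eq_div (R₂ := 1)
    (differentiableOn_conj_diskInvolution hf hm ha ha)
    (by rw [← hg, hg0]; exact (mapsTo_conj_diskInvolution hm ha ha).mono_right
          ball_subset_closedBall)
    (mem_ball_zero_iff.2 hq) (by rw [← hg, h]; simp)
  intro w hw
  rw [mem_ball_zero_iff] at hw
  have hTw := norm_diskInvolution_lt_one ha hw
  have hfw : ‖f w‖ < 1 := mem_ball_zero_iff.1 (hm (mem_ball_zero_iff.2 hw))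
  have h1 := key (mem_ball_zero_iff.2 hTw)
  rw [← hg] at h1
  simp only [hg0, h] at h1
  simp only [hg, Function.comp_apply, diskInvolution_diskInvolution ha hw, sub_zero, smul_eq_mul,
    mul_one, zero_add] at h1
  have h2 := congrArg (diskInvolution a) h1
  rwa [diskInvolution_diskInvolution ha hw, diskInvolution_diskInvolution ha hfw] at h2

/-- A holomorphic self-map of the disk with two fixed points is the identity. -/
theorem eqOn_id_of_two_fixedPoints (hf : DifferentiableOn ℂ f (ball 0 1))
    (hm : MapsTo f (ball 0 1) (ball 0 1)) {a b : ℂ} (ha : ‖a‖ < 1) (hb : ‖b‖ < 1)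
    (hfa : f a = a) (hfb : f b = b) (hab : a ≠ b) : EqOn f id (ball 0 1) := by
  have hq : diskInvolution a b ≠ 0 := by rwa [Ne, diskInvolution_eq_zero_iff ha hb]
  refine eqOn_id_of_norm_dslope_conj hf hm ha hfa (norm_diskInvolution_lt_one ha hb) ?_
  rw [dslope_of_ne _ hq, slope_def_field]
  simp [diskInvolution_zero, diskInvolution_self, diskInvolution_diskInvolution ha hb, hfa, hfb, hq]

theorem eqOn_id_of_deriv_eq_one (hf : DifferentiableOn ℂ f (ball 0 1))
    (hm : MapsTo f (ball 0 1) (ball 0 1)) {a : ℂ} (ha : ‖a‖ < 1)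
    (hfa : f a = a) (hd : HasDerivAt f 1 a) : EqOn f id (ball 0 1) := by
  refine eqOn_id_of_norm_dslope_conj hf hm ha hfa (q := 0) (by simp) ?_
  rw [dslope_same]
  have h0 := hasDerivAt_diskInvolution ha (w := 0) (by simp)
  have h1 := hasDerivAt_diskInvolution ha ha
  have h2 := one_sub_conj_mul_ne_zero ha ha
  have h3 : HasDerivAt f 1 (diskInvolution a 0) := by rwa [diskInvolution_zero]
  have h4 : HasDerivAt (f ∘ diskInvolution a) _ 0 := h3.comp 0 h0
  have h5 : (f ∘ diskInvolution a) 0 = a := by simp [diskInvolution_zero, hfa]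
  rw [← h5] at h1
  have h6 := h1.comp 0 h4
  simp only [h5] at h6
  rw [h6.deriv]
  have h7 : conj a * a - 1 ≠ 0 := by rw [← neg_ne_zero, neg_sub]; exact h2
  field_simp
  ring

end SelfMap

/-! ### Contraction centres in the closed disk -/

/-- `IsContractionCenter f a`: every horodisk (or hyperbolic disk) centred at `a` is mapped into
itself by `f`. -/
def IsContractionCenter (f : ℂ → ℂ) (a : ℂ) : Prop :=
  ∀ p : ℂ, ‖p‖ < 1 →
    Complex.normSq (1 - conj a * f p) * (1 - Complex.normSq p) ≤
      Complex.normSq (1 - conj a * p) * (1 - Complex.normSq (f p))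

section SelfMap

variable {f : ℂ → ℂ}

theorem isContractionCenter_of_fixedPoint (hf : DifferentiableOn ℂ f (ball 0 1))
    (hm : MapsTo f (ball 0 1) (ball 0 1)) {a : ℂ} (ha : ‖a‖ < 1) (hfa : f a = a) :
    IsContractionCenter f a := fun p hp => by
  have hfp : ‖f p‖ < 1 := mem_ball_zero_iff.1 (hm (mem_ball_zero_iff.2 hp))
  have h := norm_diskInvolution_map_le hf hm ha hp
  have h1 := Complex.normSq_pos.2 (one_sub_conj_mul_ne_zero ha hp)
  have h2 := Complex.normSq_pos.2 (one_sub_conj_mul_ne_zero ha hfp)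
  have h3 : 0 < 1 - Complex.normSq a := sub_pos.2 (normSq_lt_one_iff.2 ha)
  rw [hfa, ← sq_le_sq₀ (norm_nonneg _) (norm_nonneg _), ← Complex.normSq_eq_norm_sq,
    ← Complex.normSq_eq_norm_sq, normSq_diskInvolution ha hp, normSq_diskInvolution ha hfp,
    sub_le_sub_iff_left, div_le_div_iff₀ h1 h2, mul_assoc, mul_assoc,
    mul_le_mul_iff_right₀ h3] at h
  linarith

/-- Two distinct contraction centres `a`, `b` and a weight `t > 0` yield a fixed point, the hyperbolic
barycentre of `a` and `b` with weights `1` and `t`. -/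
theorem IsContractionCenter.exists_fixedPoint
    (hm : MapsTo f (ball 0 1) (ball 0 1)) {a b : ℂ} (ha : ‖a‖ ≤ 1) (hb : ‖b‖ ≤ 1) (hab : a ≠ b)
    (hfa : IsContractionCenter f a) (hfb : IsContractionCenter f b) {t : ℝ} (ht : 0 < t) :
    ∃ (p : ℂ) (s : ℝ), ‖p‖ < 1 ∧ f p = p ∧ s * p = a + t * b ∧
      s * (1 + Complex.normSq p) = 1 + Complex.normSq a + t * (1 + Complex.normSq b) := by
  set β : ℂ := a + t * b with hβ
  set S : ℝ := 1 + Complex.normSq a + t * (1 + Complex.normSq b) with hS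
  have ha' := normSq_le_one_iff.2 ha
  have hb' := normSq_le_one_iff.2 hb
  have ha0 := Complex.normSq_nonneg a
  have hb0 := Complex.normSq_nonneg b
  have hS0 : 0 < S := by positivity
  have hd : 0 < Complex.normSq (a - b) := Complex.normSq_pos.2 (sub_ne_zero.2 hab)
  have hdisc : 0 < S ^ 2 - 4 * Complex.normSq β := by
    have e : S ^ 2 - 4 * Complex.normSq β = (1 - Complex.normSq a) ^ 2
        + t ^ 2 * (1 - Complex.normSq b) ^ 2
        + 2 * t * ((1 - Complex.normSq a) * (1 - Complex.normSq b)
          + 2 * Complex.normSq (a - b)) := by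
      simp only [hS, hβ, Complex.normSq_apply, Complex.sub_re, Complex.sub_im, Complex.add_re,
        Complex.add_im, Complex.re_ofReal_mul, Complex.im_ofReal_mul]
      ring
    rw [e]
    have := mul_nonneg (sub_nonneg.2 ha') (sub_nonneg.2 hb')
    positivity
  -- The conditions `s * p = β` and `s * (1 + |p|²) = S` give `s² - S * s + |β|² = 0`. The roots
  -- have product `|β|²`, so the larger one puts `p = β / s` inside the disk.
  set s : ℝ := (S + √(S ^ 2 - 4 * Complex.normSq β)) / 2 with hs
  have hs0 : 0 < s := by positivity
  have hsq : s ^ 2 - S * s + Complex.normSq β = 0 := by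
    have := Real.sq_sqrt hdisc.le
    rw [hs]
    linear_combination this / 4
  have hsβ : Complex.normSq β < s ^ 2 := by
    have : S / 2 < s := by rw [hs]; have := Real.sqrt_pos.2 hdisc; linarith
    nlinarith
  have hsC : (s : ℂ) ≠ 0 := by exact_mod_cast hs0.ne'
  set p : ℂ := β / s with hp
  have hsp : s * p = β := by rw [hp]; field_simp
  have hnp : s ^ 2 * Complex.normSq p = Complex.normSq β := by
    rw [← hsp, map_mul, Complex.normSq_ofReal]; ring
  have hp1 : ‖p‖ < 1 := by
    rw [← normSq_lt_one_iff]
    have : 0 < s ^ 2 := by positivity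
    nlinarith
  have hsS : s * (1 + Complex.normSq p) = S := by
    refine mul_left_cancel₀ hs0.ne' ?_
    linear_combination hnp + hsq
  refine ⟨p, s, hp1, ?_, hsp, hsS⟩
  have hre : s * p.re = a.re + t * b.re := by
    simpa [hβ, Complex.re_ofReal_mul] using congrArg Complex.re hsp
  have him : s * p.im = a.im + t * b.im := by
    simpa [hβ, Complex.im_ofReal_mul] using congrArg Complex.im hsp
  set m : ℝ := s - (Complex.normSq a + t * Complex.normSq b) with hmdef
  -- Adding the two weighted contraction inequalities and applying this identity at `p` and at `f p`
  -- cancels the terms in `m`, leaving only the square of `|f p - p|`.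
  have key : ∀ w : ℂ, Complex.normSq (1 - conj a * w) + t * Complex.normSq (1 - conj b * w)
      = m * (1 - Complex.normSq w) + s * Complex.normSq (w - p) := by
    intro w
    rw [hS] at hsS
    simp only [hmdef, Complex.normSq_apply, Complex.sub_re, Complex.sub_im, Complex.mul_re,
      Complex.mul_im, Complex.conj_re, Complex.conj_im, Complex.one_re, Complex.one_im] at hsS ⊢
    linear_combination 2 * w.re * hre + 2 * w.im * him - hsS
  have hfp : f p ∈ ball (0 : ℂ) 1 := hm (mem_ball_zero_iff.2 hp1)
  have h1 := hfa p hp1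
  have h2 := mul_le_mul_of_nonneg_left (hfb p hp1) ht.le
  have k1 := key p
  have k2 := key (f p)
  rw [sub_self, map_zero, mul_zero, add_zero] at k1
  have hpp : 0 < 1 - Complex.normSq p := sub_pos.2 (normSq_lt_one_iff.2 hp1)
  have h3 : s * Complex.normSq (f p - p) * (1 - Complex.normSq p) ≤ 0 := by
    have e1 := congrArg (· * (1 - Complex.normSq p)) k2
    have e2 := congrArg (· * (1 - Complex.normSq (f p))) k1
    linarith
  have h4 : Complex.normSq (f p - p) ≤ 0 := by
    by_contra! hc
    exact absurd h3 (not_le.2 (by positivity))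
  exact sub_eq_zero.1 (Complex.normSq_eq_zero.1 (le_antisymm h4 (Complex.normSq_nonneg _)))

/-- The hypothesis rearranges to `b - p = b * p * conj (b - p)`, whose norms disagree unless `b =
p`, since `|b| * |p| < 1`. -/
theorem eq_of_one_add_normSq_mul_eq {b p : ℂ} (hb : ‖b‖ ≤ 1) (hp : ‖p‖ < 1)
    (h : b * (1 + Complex.normSq p) = p * (1 + Complex.normSq b)) : b = p := by
  by_contra hne
  have h1 : b - p = b * p * conj (b - p) := by
    rw [Complex.normSq_eq_conj_mul_self, Complex.normSq_eq_conj_mul_self] at h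
    rw [map_sub]
    linear_combination h
  have h2 := congrArg norm h1
  rw [norm_mul, norm_mul, Complex.norm_conj] at h2
  have h3 : 0 < ‖b - p‖ := norm_pos_iff.2 (sub_ne_zero.2 hne)
  have h4 : ‖b‖ * ‖p‖ < 1 := by nlinarith [norm_nonneg b, norm_nonneg p]
  nlinarith

/-- A holomorphic self-map of the disk with two contraction centres in the closed disk is the
identity. -/
theorem IsContractionCenter.eqOn_id (hf : DifferentiableOn ℂ f (ball 0 1))
    (hm : MapsTo f (ball 0 1) (ball 0 1)) {a b : ℂ} (ha : ‖a‖ ≤ 1) (hb : ‖b‖ ≤ 1) (hab : a ≠ b)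
    (hfa : IsContractionCenter f a) (hfb : IsContractionCenter f b) :
    EqOn f id (ball 0 1) := by
  obtain ⟨p, s, hp, hfp, h1, h2⟩ :=
    hfa.exists_fixedPoint hm ha hb hab hfb zero_lt_one
  obtain ⟨q, r, hq, hfq, h3, h4⟩ :=
    hfa.exists_fixedPoint hm ha hb hab hfb zero_lt_two
  refine eqOn_id_of_two_fixedPoints hf hm hp hq hfp hfq ?_
  -- If the barycentres for weights `1` and `2` coincided, eliminating between their equations would
  -- make both `a` and `b` equal to `p`.
  rintro rfl
  have h2' : (s : ℂ) * (1 + Complex.normSq p)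
      = 1 + Complex.normSq a + (1 : ℝ) * (1 + Complex.normSq b) := by exact_mod_cast h2
  have h4' : (r : ℂ) * (1 + Complex.normSq p)
      = 1 + Complex.normSq a + (2 : ℝ) * (1 + Complex.normSq b) := by exact_mod_cast h4
  push_cast at h1 h3 h2' h4'
  apply hab
  rw [eq_of_one_add_normSq_mul_eq hb hp, eq_of_one_add_normSq_mul_eq ha hp]
  · linear_combination p * (2 * h2' - h4') - (1 + Complex.normSq p : ℂ) * (2 * h1 - h3)
  · linear_combination p * (h4' - h2') - (1 + Complex.normSq p : ℂ) * (h3 - h1)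

end SelfMap

/-! ### Fixed points for `z` in the open disk -/

theorem norm_diskInvolution_mul_lt {z c d : ℂ} (hz : ‖z‖ < 1) (hc : ‖c‖ < 1) (hd : ‖d‖ < 1)
    (hcd : c ≠ d) : ‖diskInvolution (z * c) (z * d)‖ < ‖diskInvolution c d‖ := by
  have hzc : ‖z * c‖ < 1 := by
    rw [norm_mul]; exact mul_lt_one_of_nonneg_of_lt_one_left (norm_nonneg _) hz hc.le
  have hzd : ‖z * d‖ < 1 := by
    rw [norm_mul]; exact mul_lt_one_of_nonneg_of_lt_one_left (norm_nonneg _) hz hd.le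
  have h1 := Complex.normSq_pos.2 (one_sub_conj_mul_ne_zero hc hd)
  have h2 := Complex.normSq_pos.2 (one_sub_conj_mul_ne_zero hzc hzd)
  have h3 := Complex.normSq_pos.2 (sub_ne_zero.2 hcd)
  have e : Complex.normSq (1 - conj (z * c) * (z * d))
      - Complex.normSq z * Complex.normSq (1 - conj c * d)
      = (1 - Complex.normSq z) *
        (1 - Complex.normSq z * (Complex.normSq c * Complex.normSq d)) := by
    simp only [Complex.normSq_apply, Complex.sub_re, Complex.sub_im, Complex.mul_re,
      Complex.mul_im, Complex.conj_re, Complex.conj_im, Complex.one_re, Complex.one_im]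
    ring
  have hlt : Complex.normSq z * Complex.normSq (1 - conj c * d)
      < Complex.normSq (1 - conj (z * c) * (z * d)) := by
    rw [← sub_pos, e]
    have hcd1 : Complex.normSq (z * c) * Complex.normSq d < 1 :=
      mul_lt_one_of_nonneg_of_lt_one_left (Complex.normSq_nonneg _)
        (normSq_lt_one_iff.2 hzc) (normSq_lt_one_iff.2 hd).le
    rw [map_mul, mul_assoc] at hcd1
    exact mul_pos (sub_pos.2 (normSq_lt_one_iff.2 hz)) (sub_pos.2 hcd1)
  rw [← sq_lt_sq₀ (norm_nonneg _) (norm_nonneg _), ← Complex.normSq_eq_norm_sq,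
    ← Complex.normSq_eq_norm_sq, diskInvolution, diskInvolution, map_div₀, map_div₀, ← mul_sub,
    map_mul, div_lt_div_iff₀ h2 h1]
  nlinarith

section Subordination

variable {φ : ℂ → ℂ} {z : ℂ}

theorem mapsTo_const_mul (hm : MapsTo φ (ball 0 1) (ball 0 1)) (hz : ‖z‖ ≤ 1) :
    MapsTo (fun w => z * φ w) (ball 0 1) (ball 0 1) := fun w hw => by
  have := mem_ball_zero_iff.1 (hm hw)
  rw [mem_ball_zero_iff, norm_mul]
  exact mul_lt_one_of_nonneg_of_lt_one_right hz (norm_nonneg _) this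

theorem not_eqOn_const_mul_id (hm : MapsTo φ (ball 0 1) (ball 0 1)) (h : φ 0 ≠ 0 ∨ ‖z‖ < 1) :
    ¬ EqOn (fun w => z * φ w) id (ball 0 1) := by
  intro he
  rcases eq_or_ne z 0 with rfl | hz
  · have := he (show (1 / 2 : ℂ) ∈ ball (0 : ℂ) 1 by rw [mem_ball_zero_iff]; norm_num)
    norm_num at this
  · rcases h with h | h
    · have := he (mem_ball_self one_pos)
      simp [hz, h] at this
    · have hzm := mem_ball_zero_iff.2 h
      have h1 : φ z = 1 := mul_left_cancel₀ hz (by simpa using he hzm)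
      have h2 := mem_ball_zero_iff.1 (hm hzm)
      simp [h1] at h2

theorem fixedPoint_unique (hφ : DifferentiableOn ℂ φ (ball 0 1))
    (hm : MapsTo φ (ball 0 1) (ball 0 1)) (hz : ‖z‖ < 1) {a b : ℂ} (ha : ‖a‖ < 1) (hb : ‖b‖ < 1)
    (hfa : a = z * φ a) (hfb : b = z * φ b) : a = b := by
  by_contra hab
  exact not_eqOn_const_mul_id hm (.inr hz) (eqOn_id_of_two_fixedPoints (hφ.const_mul z)
    (mapsTo_const_mul hm hz.le) ha hb hfa.symm hfb.symm hab)

/-- The displacement from `w` to `z * φ w` attains a minimum on the closed disk of radius `‖z‖`,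
which the map preserves. At a minimiser that is not fixed, moving to the image would strictly
decrease it. -/
theorem exists_fixedPoint (hφ : DifferentiableOn ℂ φ (ball 0 1))
    (hm : MapsTo φ (ball 0 1) (ball 0 1)) (hz : ‖z‖ < 1) : ∃ w, ‖w‖ < 1 ∧ w = z * φ w := by
  have hsub : closedBall (0 : ℂ) ‖z‖ ⊆ ball 0 1 := closedBall_subset_ball hz
  have hmz := mapsTo_const_mul hm hz.le
  have hcont : ContinuousOn (fun w => z * φ w) (closedBall 0 ‖z‖) :=
    ((hφ.const_mul z).continuousOn).mono hsub
  have hc : ContinuousOn (fun w => ‖diskInvolution w (z * φ w)‖) (closedBall 0 ‖z‖) := by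
    refine (ContinuousOn.div (continuousOn_id.sub hcont) (continuousOn_const.sub
      (Complex.continuous_conj.continuousOn.mul hcont)) fun w hw => ?_).norm
    exact one_sub_conj_mul_ne_zero (mem_ball_zero_iff.1 (hsub hw))
      (mem_ball_zero_iff.1 (hmz (hsub hw)))
  obtain ⟨w, hw, hmin⟩ := (isCompact_closedBall (0 : ℂ) ‖z‖).exists_isMinOn
    ⟨0, mem_closedBall_self (norm_nonneg z)⟩ hc
  have hw1 := mem_ball_zero_iff.1 (hsub hw)
  have hφw := mem_ball_zero_iff.1 (hm (hsub hw))
  have hv := hmz (hsub hw)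
  refine ⟨w, hw1, ?_⟩
  by_contra hne
  set v := z * φ w with hvdef
  have hv' : v ∈ closedBall (0 : ℂ) ‖z‖ := by
    rw [mem_closedBall_zero_iff, hvdef, norm_mul]
    exact mul_le_of_le_one_right (norm_nonneg z) hφw.le
  have h1 : ‖diskInvolution w v‖ ≤ ‖diskInvolution v (z * φ v)‖ := hmin hv'
  rcases eq_or_ne (φ w) (φ v) with heq | hφne
  · have h2 : v = z * φ v := by rw [← heq]
    rw [← h2, diskInvolution_self, norm_zero, norm_le_zero_iff,
      diskInvolution_eq_zero_iff hw1 (mem_ball_zero_iff.1 hv)] at h1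
    exact hne h1
  · have h2 := norm_diskInvolution_mul_lt hz hφw (mem_ball_zero_iff.1 (hm hv)) hφne
    have h3 := norm_diskInvolution_map_le hφ hm hw1 (mem_ball_zero_iff.1 hv)
    exact absurd h1 (not_le.2 (h2.trans_le h3))

/-! ### Limits, continuity and analyticity of the fixed point -/

/-- Limits of the fixed points of `w ↦ z * φ w` are contraction centres of the limit map. -/
theorem isContractionCenter_of_tendsto (hφ : DifferentiableOn ℂ φ (ball 0 1))
    (hm : MapsTo φ (ball 0 1) (ball 0 1)) {ω : ℂ → ℂ} (hω : MapsTo ω (ball 0 1) (ball 0 1))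
    (he : ∀ z ∈ ball (0 : ℂ) 1, ω z = z * φ (ω z)) {l : Filter ℂ} [l.NeBot]
    (hl : l ≤ 𝓝[ball 0 1] z) {a : ℂ} (ha : Tendsto ω l (𝓝 a)) :
    IsContractionCenter (fun w => z * φ w) a := by
  intro p hp
  have hz : Tendsto (fun x : ℂ => x) l (𝓝 z) := hl.trans nhdsWithin_le_nhds
  have hn : Continuous Complex.normSq := Complex.continuous_normSq
  have hzp := hz.mul_const (φ p)
  have hconj := (Complex.continuous_conj.tendsto a).comp ha
  refine le_of_tendsto_of_tendsto
    ((((hn.tendsto _).comp ((hconj.mul hzp).const_sub 1))).mul_const (1 - Complex.normSq p))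
    (((hn.tendsto _).comp ((hconj.mul_const p).const_sub 1)).mul
      (((hn.tendsto _).comp hzp).const_sub 1)) ?_
  filter_upwards [hl self_mem_nhdsWithin] with x hx
  have hx' := mem_ball_zero_iff.1 hx
  exact isContractionCenter_of_fixedPoint (hφ.const_mul x) (mapsTo_const_mul hm hx'.le)
    (mem_ball_zero_iff.1 (hω hx)) (he x hx).symm p hp

theorem exists_tendsto_fixedPoint (hφ : DifferentiableOn ℂ φ (ball 0 1))
    (hm : MapsTo φ (ball 0 1) (ball 0 1)) (h0 : φ 0 ≠ 0) {ω : ℂ → ℂ}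
    (hω : MapsTo ω (ball 0 1) (ball 0 1)) (he : ∀ z ∈ ball (0 : ℂ) 1, ω z = z * φ (ω z))
    (hz : z ∈ closedBall (0 : ℂ) 1) :
    ∃ y ∈ closedBall (0 : ℂ) 1, Tendsto ω (𝓝[ball 0 1] z) (𝓝 y) := by
  have hne : (𝓝[ball (0 : ℂ) 1] z).NeBot := by
    rw [← mem_closure_iff_nhdsWithin_neBot, closure_ball (0 : ℂ) one_ne_zero]
    exact hz
  have hmem : ∀ᶠ x in 𝓝[ball 0 1] z, ω x ∈ closedBall (0 : ℂ) 1 := by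
    filter_upwards [self_mem_nhdsWithin] with x hx using ball_subset_closedBall (hω hx)
  have hcenter : ∀ a, MapClusterPt a (𝓝[ball 0 1] z) ω →
      IsContractionCenter (fun w => z * φ w) a := fun a ha => by
    -- An ultrafilter turns the cluster point into a genuine limit.
    obtain ⟨U, hU, hUa⟩ := mapClusterPt_iff_ultrafilter.1 ha
    exact isContractionCenter_of_tendsto hφ hm hω he hU hUa
  obtain ⟨y, hy, hyc⟩ := (isCompact_closedBall (0 : ℂ) 1).exists_mapClusterPt_of_frequently
    hmem.frequently
  refine ⟨y, hy, (isCompact_closedBall (0 : ℂ) 1).tendsto_nhds_of_unique_mapClusterPt hmem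
    fun a ha hac => ?_⟩
  by_contra hay
  rw [mem_closedBall_zero_iff] at hz ha hy
  exact not_eqOn_const_mul_id hm (.inl h0) (IsContractionCenter.eqOn_id (hφ.const_mul z)
    (mapsTo_const_mul hm hz) ha hy hay (hcenter a hac) (hcenter y hyc))

/-- Near `z`, `ω` inverts `w ↦ w / φ w`. The derivative of this quotient vanishes at `ω z` only if
`z * φ'(ω z) = 1`, which would make `w ↦ z * φ w` the identity. -/
theorem differentiableAt_fixedPoint (hφ : DifferentiableOn ℂ φ (ball 0 1))
    (hm : MapsTo φ (ball 0 1) (ball 0 1)) (h0 : φ 0 ≠ 0) {ω : ℂ → ℂ}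
    (hω : MapsTo ω (ball 0 1) (ball 0 1)) (he : ∀ z ∈ ball (0 : ℂ) 1, ω z = z * φ (ω z))
    (hz : z ∈ ball (0 : ℂ) 1) (hc : ContinuousAt ω z) : DifferentiableAt ℂ ω z := by
  have hne : ∀ x ∈ ball (0 : ℂ) 1, φ (ω x) ≠ 0 := fun x hx h => by
    have h1 := he x hx
    rw [h, mul_zero] at h1
    exact h0 (h1 ▸ h)
  have hd := (hφ.differentiableAt (isOpen_ball.mem_nhds (hω hz))).hasDerivAt
  have hd' := (hasDerivAt_id (ω z)).div hd (hne z hz)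
  refine (hd'.of_local_left_inverse hc ?_ ?_).differentiableAt
  · simp only [id, one_mul]
    refine div_ne_zero (fun h => ?_) (pow_ne_zero 2 (hne z hz))
    have h1 : z * deriv φ (ω z) = 1 := by
      refine mul_left_cancel₀ (hne z hz) ?_
      linear_combination -h - deriv φ (ω z) * he z hz
    refine not_eqOn_const_mul_id hm (.inl h0) (eqOn_id_of_deriv_eq_one (hφ.const_mul z)
      (mapsTo_const_mul hm (mem_ball_zero_iff.1 hz).le) (mem_ball_zero_iff.1 (hω hz))
      (he z hz).symm ?_)
    exact h1 ▸ hd.const_mul z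
  · filter_upwards [isOpen_ball.mem_nhds hz] with x hx
    change ω x / φ (ω x) = x
    rw [div_eq_iff (hne x hx)]
    exact he x hx

/-! ### Existence and uniqueness -/

theorem exists_isSubordination (hφ : DifferentiableOn ℂ φ (ball 0 1))
    (hm : MapsTo φ (ball 0 1) (ball 0 1)) : ∃ ω, IsSubordination φ ω := by
  -- The case `φ 0 = 0` is separate because the boundary argument can fail there: for `φ w = w` and
  -- `z = 1` the map is the identity.
  by_cases h0 : φ 0 = 0
  · exact ⟨fun _ => 0, fun _ _ => mem_closedBall_self zero_le_one, continuousOn_const,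
      analyticOnNhd_const, rfl, fun z _ => by simp [h0]⟩
  choose! ω₀ hω₀ he₀ using fun z (hz : z ∈ ball (0 : ℂ) 1) =>
    exists_fixedPoint hφ hm (mem_ball_zero_iff.1 hz)
  have hmaps : MapsTo ω₀ (ball 0 1) (ball 0 1) := fun z hz => mem_ball_zero_iff.2 (hω₀ z hz)
  have hcl : closure (ball (0 : ℂ) 1) = closedBall 0 1 := closure_ball (0 : ℂ) one_ne_zero
  have hlim := fun z (hz : z ∈ closedBall (0 : ℂ) 1) =>
    exists_tendsto_fixedPoint hφ hm h0 hmaps he₀ hz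
  have hcont : ContinuousOn ω₀ (ball 0 1) := fun z hz => by
    obtain ⟨y, -, hy⟩ := hlim z (ball_subset_closedBall hz)
    -- The filter `𝓝[ball 0 1] z` includes `z` itself, so the limit must be the value at `z`.
    have : ω₀ z = y := tendsto_nhds_unique
      (tendsto_pure_nhds ω₀ z) (hy.mono_left (pure_le_nhdsWithin hz))
    rwa [ContinuousWithinAt, this]
  set ω := extendFrom (ball 0 1) ω₀ with hωdef
  have hext : EqOn ω ω₀ (ball 0 1) := extendFrom_extends hcont
  have hωmaps : MapsTo ω (ball 0 1) (ball 0 1) := hmaps.congr hext.symm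
  have heω : ∀ z ∈ ball (0 : ℂ) 1, ω z = z * φ (ω z) := fun z hz => by
    rw [hext hz]; exact he₀ z hz
  have hωcont : ContinuousOn ω (closedBall 0 1) := continuousOn_extendFrom hcl.ge
    fun z hz => let ⟨y, _, hy⟩ := hlim z hz; ⟨y, hy⟩
  refine ⟨ω, fun z hz => ?_, hωcont, DifferentiableOn.analyticOnNhd (fun z hz => ?_) isOpen_ball,
    by simpa using heω 0 (mem_ball_self one_pos), heω⟩
  · obtain ⟨y, hy, hy'⟩ := hlim z hz
    rw [hωdef, extendFrom_eq (hcl.ge hz) hy']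
    exact hy
  · exact (differentiableAt_fixedPoint hφ hm h0 hωmaps heω hz ((hωcont.mono
      ball_subset_closedBall).continuousAt (isOpen_ball.mem_nhds hz))).differentiableWithinAt

theorem IsSubordination.mapsTo_ball {ω : ℂ → ℂ} (h : IsSubordination φ ω) :
    MapsTo ω (ball 0 1) (ball 0 1) := fun z hz => by
  rw [mem_ball_zero_iff] at hz ⊢
  exact (Complex.norm_le_norm_of_mapsTo_ball h.analyticOnNhd.differentiableOn
    (h.mapsTo.mono_left ball_subset_closedBall) h.map_zero hz).trans_lt hz

theorem IsSubordination.eqOn (hφ : DifferentiableOn ℂ φ (ball 0 1))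
    (hm : MapsTo φ (ball 0 1) (ball 0 1)) {ω ω' : ℂ → ℂ} (h : IsSubordination φ ω)
    (h' : IsSubordination φ ω') : EqOn ω ω' (closedBall 0 1) := by
  have hE : EqOn ω ω' (ball 0 1) := fun z hz =>
    fixedPoint_unique hφ hm (mem_ball_zero_iff.1 hz) (mem_ball_zero_iff.1 (h.mapsTo_ball hz))
      (mem_ball_zero_iff.1 (h'.mapsTo_ball hz)) (h.eq z hz) (h'.eq z hz)
  exact hE.of_subset_closure h.continuousOn h'.continuousOn ball_subset_closedBall
    (closure_ball (0 : ℂ) one_ne_zero).ge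

end Subordination

theorem corollary3p1 (φ : ℂ → ℂ)
    (hφ : AnalyticOnNhd ℂ φ (Metric.ball 0 1))
    (hφ_maps : Set.MapsTo φ (Metric.ball 0 1) (Metric.ball 0 1)) :
    ∃ ω : ℂ → ℂ, IsSubordination φ ω ∧
      Set.MapsTo ω (Metric.ball 0 1) (Metric.ball 0 1) ∧
      ∀ ω' : ℂ → ℂ, IsSubordination φ ω' →
        Set.EqOn ω' ω (Metric.closedBall 0 1) := by
  obtain ⟨ω, hω⟩ := exists_isSubordination hφ.differentiableOn hφ_maps
  exact ⟨ω, hω, hω.mapsTo_ball, fun ω' hω' => hω'.eqOn hφ.differentiableOn hφ_maps hω⟩
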